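/- Let $n>1$, $\tau,\hbar\in\mathbb{C}$ with $\operatorname{Im}\tau>0$ and $\hbar\notin\mathbb{Z}+\mathbb{Z}\tau$. Put $$\theta_{m,l}(u,\tau)=\sum_{\mu\in m+l\mathbb{Z}}\exp 2\pi i\Bigl(\mu u+\tfrac{\mu^2}{2l}\tau\Bigr),\qquad \theta(u)=\theta_{\frac12,1}(u+\tfrac12,\tau),\qquad \theta_j(u)=\theta_{\frac n2-j,n}(u+\tfrac12,\tau),$$ and let $\eta$ be the Dedekind eta function. Let $\mathbf{h}^*\subset\mathbb{C}^n$ be the orthogonal complement of $\epsilon_1+\cdots+\epsilon_n$ for the standard bilinear form $\langle\cdot,\cdot\rangle$, let $\bar\epsilon_k$ be the orthogonal projection of $\epsilon_k$ to $\mathbf{h}^*$, and put $(T_kf)(\lambda)=f(\lambda+\hbar\bar\epsilon_k)$ for functions $f$ on $\mathbf{h}^*$. For $\lambda\in\mathbf{h}^*$ set $$\phi(u)_{\lambda,j}^{k}=\frac{\theta_j(\frac un-\langle\lambda,\bar\epsilon_k\rangle)}{\sqrt{-1}\,\eta(\tau)}\qquad(j,k=1,\dots,n),$$ and let $[\bar\phi(u)_\lambda^{k,j}]_{k,j}$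 be the inverse of the matrix $[\phi(u)_{\lambda,j}^{k}]_{j,k}$. For $c,u\in\mathbb{C}$ define the matrices of difference operators $L(c|u)=[L(c|u)^i_j]$ and $\tilde L(c|u)=[\tilde L(c|u)^{i}_{j}]$, $1\le i,j\le n$, by $$L(c|u)^i_j=\sum_{k=1}^n\phi(u+c\hbar)_{\lambda,j}^{k}\,\bar\phi(u)_\lambda^{k,i}\,T_k,\qquad \tilde L(c|u)^{i}_{j}=\sum_{a,b=1}^n\bar\phi(u)_\lambda^{j,b}\,\phi(u)_{\lambda,a}^{i}\,L(c|u)^a_b .$$ For $0\le d\le n$ let $M_d(c|u)$ be the trace of the $d$-th antisymmetrically fused L-operator, $$M_d(c|u)=\sum_{1\le i_1<\cdots<i_d\le n}\ \sum_{\sigma\in S(d)}\operatorname{sgn}(\sigma)\,L(c|u)^{i_{\sigma(1)}}_{i_1}\,L(c|u-\hbar)^{i_{\sigma(2)}}_{i_2}\cdots L(c|u-(d-1)\hbar)^{i_{\sigma(d)}}_{i_d},$$ a composition of operators in the order written, so that $M_0(c|u)=\mathrm{id}$. Let ${:}\ {:}$ denote the normal product of difference operators, in which all shift operators are put to the right of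 all functions, ${:}f(\lambda)T\,g(\lambda)T'{:}=f(\lambda)g(\lambda)TT'$; under it difference operators multiply commutatively, and ${:}\det A{:}$ is the determinant of a matrix $A$ of difference operators formed with this product. Assume $\theta(u-k\hbar)\neq0$ for $0\le k\le n-1$. Then for every $t\in\mathbb{C}$ $$\sum_{d=0}^n(-t)^{n-d}M_d(c|u)={:}\det[L(c|u)-t]{:}={:}\det[\tilde L(c|u)-t]{:}$$ as difference operators. More precisely, the three operators, applied to an arbitrary function $f:\mathbf{h}^*\to\mathbb{C}$, have the same value at every $\lambda\in\mathbf{h}^*$ such that $\theta(\langle\lambda,\bar\epsilon_i-\bar\epsilon_j\rangle+m\hbar)\neq0$ for all $i\neq j$ and all integers $m$ with $|m|<n$. -/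

import Mathlib

open Complex

noncomputable section

namespace EllipticRuijsenaars

/-! ### Theta functions -/

/-- `θ_{m,l}(u, τ) = ∑_{μ ∈ m + lℤ} exp 2πi (μ u + μ² τ / (2l))`. -/
def thetaChar (m : ℂ) (l : ℕ) (u τ : ℂ) : ℂ :=
  ∑' k : ℤ, Complex.exp (2 * Real.pi * I *
    ((m + l * k) * u + (m + l * k) ^ 2 / (2 * l) * τ))

/-- The Jacobi theta function `θ(u) = θ_{1/2,1}(u + 1/2, τ)`. -/
def theta (τ u : ℂ) : ℂ := thetaChar (1 / 2) 1 (u + 1 / 2) τ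

/-- `θ_j(u) = θ_{n/2-j,n}(u + 1/2, τ)`. -/
def thetaIdx (n : ℕ) (τ : ℂ) (j : ℕ) (u : ℂ) : ℂ :=
  thetaChar ((n : ℂ) / 2 - j) n (u + 1 / 2) τ

/-! ### The weight space of type `A_{n-1}` -/

/-- The orthogonal complement of `ε_1 + ⋯ + ε_n` in `ℂⁿ`. -/
def weightSpace (n : ℕ) : Submodule ℂ (Fin n → ℂ) where
  carrier := {v | ∑ i, v i = 0}
  add_mem' := by
    intro a b ha hb
    simp only [Set.mem_ofPred_eq, Pi.add_apply, Finset.sum_add_distrib] at *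
    rw [ha, hb, add_zero]
  zero_mem' := by simp
  smul_mem' := by
    intro c a ha
    simp only [Set.mem_ofPred_eq, Pi.smul_apply, smul_eq_mul] at *
    rw [← Finset.mul_sum, ha, mul_zero]

/-- The orthogonal projection `ε̄_k = ε_k - (ε_1 + ⋯ + ε_n) / n` of the `k`-th basis vector. -/
def epsBar (n : ℕ) (k : Fin n) : weightSpace n :=
  ⟨fun i => (if i = k then 1 else 0) - 1 / (n : ℂ), by
    have hn : (n : ℂ) ≠ 0 := Nat.cast_ne_zero.mpr (Fin.pos k).ne'
    change ∑ i, ((if i = k then (1 : ℂ) else 0) - 1 / (n : ℂ)) = 0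
    simp [Finset.sum_sub_distrib, hn]⟩

/-- The standard bilinear form on `ℂⁿ`, restricted to the weight space. -/
def pairing {n : ℕ} (v w : weightSpace n) : ℂ := ∑ i, v.1 i * w.1 i

/-- Functions on the weight space. -/
abbrev Fn (n : ℕ) : Type := weightSpace n → ℂ

/-- Linear operators on functions on the weight space. -/
abbrev Op (n : ℕ) : Type := Module.End ℂ (Fn n)

/-- The operator of multiplication by `a`. -/
def mulOp {n : ℕ} (a : Fn n) : Op n where
  toFun f := fun v => a v * f v
  map_add' f g := by ext v; simp [mul_add]
  map_smul' r f := by ext v; simp; ring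

/-- The shift operator `(T f)(v) = f(v + w)`. -/
def shiftOp {n : ℕ} (w : weightSpace n) : Op n where
  toFun f := fun v => f (v + w)
  map_add' _ _ := rfl
  map_smul' _ _ := rfl

/-! ### Difference operators and the normal product -/

/-- Normally ordered expressions `∑_w a_w(λ) T^w` (a finite sum over shifts `w`), with the
commutative product `(a T^w)(b T^{w'}) = a b T^{w + w'}`. -/
abbrev DiffSymbol (n : ℕ) : Type := AddMonoidAlgebra (Fn n) (weightSpace n)

/-- The difference operator of a normally ordered expression: the coefficient functions act by
multiplication, to the left of the shifts. -/
def quantize {n : ℕ} (s : DiffSymbol n) : Op n :=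
  s.coeff.sum fun w a => mulOp a * shiftOp w

theorem quantize_apply {n : ℕ} (s : DiffSymbol n) (f : Fn n) (v : weightSpace n) :
    quantize s f v = s.coeff.sum fun w a => a v * f (v + w) := by
  simp [quantize, Finsupp.sum, LinearMap.sum_apply, Finset.sum_apply, mulOp, shiftOp]

theorem quantize_single {n : ℕ} (w : weightSpace n) (a : Fn n) :
    quantize (AddMonoidAlgebra.single w a) = mulOp a * shiftOp w := by
  ext f v
  rw [quantize_apply, AddMonoidAlgebra.coeff_single, Finsupp.sum_single_index (by simp)]
  rfl

theorem quantize_add {n : ℕ} (s s' : DiffSymbol n) :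
    quantize (s + s') = quantize s + quantize s' := by
  ext f v
  simp only [LinearMap.add_apply, Pi.add_apply, quantize_apply, AddMonoidAlgebra.coeff_add]
  exact Finsupp.sum_add_index' (by simp) (by intro w a b; simp [add_mul])

/-- A difference operator has only one normally ordered expression. -/
theorem quantize_injective {n : ℕ} : Function.Injective (quantize (n := n)) := by
  classical
  intro s s' h
  have key : ∀ (r : DiffSymbol n) (v w : weightSpace n),
      quantize r (fun x => if x = v + w then 1 else 0) v = r.coeff w v := by
    intro r v w
    rw [quantize_apply, Finsupp.sum]
    simp only [add_right_inj, mul_ite, mul_one, mul_zero, Finset.sum_ite_eq']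
    split_ifs with hw
    · rfl
    · rw [Finsupp.notMem_support_iff.mp hw]; rfl
  apply AddMonoidAlgebra.coeff_injective
  ext w v
  rw [← key s v w, ← key s' v w, h]

/-- The normally ordered expression of a difference operator (a junk value on operators that are
not finite sums of functions times shifts). -/
def symbol {n : ℕ} : Op n → DiffSymbol n := Function.invFun quantize

theorem symbol_quantize {n : ℕ} (s : DiffSymbol n) : symbol (quantize s) = s :=
  Function.leftInverse_invFun quantize_injective s

/-- The normally ordered determinant `:det A:` of a matrix of difference operators: the
determinant is expanded with respect to the normal product, in which all shifts are put to the
right of all functions. -/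
def normalDet {n : ℕ} (A : Matrix (Fin n) (Fin n) (Op n)) : Op n :=
  quantize (A.map symbol).det

/-! ### Intertwining vectors and the factorized L-operator -/

/-- The matrix `[φ(u)^{μ+ħε̄_k}_μ _j]_{j,k}` of outgoing intertwining vectors, with entries
`θ_j(u/n - ⟨μ, ε̄_k⟩) / (√-1 η(τ))`; the index `j : Fin n` stands for `j + 1 ∈ {1, …, n}`. -/
def outVec (n : ℕ) (τ u : ℂ) (μ : weightSpace n) : Matrix (Fin n) (Fin n) ℂ :=
  Matrix.of fun j k =>
    thetaIdx n τ (j + 1) (u / n - pairing μ (epsBar n k)) / (I * ModularForm.eta τ)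

/-- The incoming intertwining vectors `[φ̄(u)^{μ+ħε̄_k}_μ ^j]_{k,j}`: the inverse matrix. -/
def inVec (n : ℕ) (τ u : ℂ) (μ : weightSpace n) : Matrix (Fin n) (Fin n) ℂ :=
  (outVec n τ u μ)⁻¹

/-- The factorized L-operator `L(c|u)`; the entry `i j` is `L(c|u)^i_j`, that is
`(L(c|u)^i_j f)(μ) = ∑_k φ(u+cħ)^{μ+ħε̄_k}_{μ,j} φ̄(u)^{μ+ħε̄_k,i}_μ f(μ+ħε̄_k)`. -/
def lOp (n : ℕ) (τ ℏ c u : ℂ) : Matrix (Fin n) (Fin n) (Op n) :=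
  Matrix.of fun i j => ∑ k : Fin n,
    mulOp (fun μ => outVec n τ (u + c * ℏ) μ j k * inVec n τ u μ k i) * shiftOp (ℏ • epsBar n k)

/-- The conjugated Lax matrix `L̃(c|u)`; the entry `i' j'` is `L̃(c|u)^{i'}_{j'}`, that is
`∑_{i,j} φ̄(u)^{λ+ħε̄_{j'},j}_λ φ(u)^{λ+ħε̄_{i'}}_{λ,i} L(c|u)^i_j`. -/
def lTildeOp (n : ℕ) (τ ℏ c u : ℂ) : Matrix (Fin n) (Fin n) (Op n) :=
  Matrix.of fun i' j' => ∑ i : Fin n, ∑ j : Fin n,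
    mulOp (fun v => inVec n τ u v j' j * outVec n τ u v i i') * lOp n τ ℏ c u i j

/-! ### Fusion and the transfer matrices -/

/-- The fused L-operator `L(c|1^d_u)` in the degree `d` exterior representation. The increasing
sequences `i_1 < ⋯ < i_d` in `{1, …, n}` index the basis, and the entry `(I, I')` is
`∑_σ sgn(σ) L(c|u)^{i_σ(1)}_{i'_1} L(c|u-ħ)^{i_σ(2)}_{i'_2} ⋯ L(c|u-(d-1)ħ)^{i_σ(d)}_{i'_d}`,
the product being composition of operators in this order. -/
def fusedL (n : ℕ) (τ ℏ c u : ℂ) (d : ℕ) :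
    Matrix (Fin d ↪o Fin n) (Fin d ↪o Fin n) (Op n) :=
  Matrix.of fun i i' => ∑ σ : Equiv.Perm (Fin d),
    (Equiv.Perm.sign σ : ℤ) •
      (List.ofFn fun a : Fin d => lOp n τ ℏ c (u - (a : ℕ) * ℏ) (i (σ a)) (i' a)).prod

/-- `M_d(c|u)`, the trace of the fused L-operator. -/
def transferM (n : ℕ) (τ ℏ c u : ℂ) (d : ℕ) : Op n :=
  (fusedL n τ ℏ c u d).trace

/-- `M_0(c|u)` is the identity. -/
theorem transferM_zero (n : ℕ) (τ ℏ c u : ℂ) : transferM n τ ℏ c u 0 = 1 := by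
  have : Unique (Fin 0 ↪o Fin n) :=
    { default := OrderEmbedding.ofStrictMono Fin.elim0 (fun a => a.elim0)
      uniq := fun g => by ext a; exact a.elim0 }
  simp [transferM, fusedL, Matrix.trace]

/-- The points of the weight space at which none of the coefficients of the operators `L(c|·)`
that enter `M_0, …, M_n` has a pole in `λ`: `θ(⟨λ, ε̄_i - ε̄_j⟩ + mħ) ≠ 0` for `i ≠ j` and
integers `|m| < n`. -/
def regularSet (n : ℕ) (τ ℏ : ℂ) : Set (weightSpace n) :=
  {v | ∀ i j : Fin n, i ≠ j → ∀ m : ℤ, |m| < n →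
    theta τ (pairing v (epsBar n i - epsBar n j) + m * ℏ) ≠ 0}

end EllipticRuijsenaars

end

/-!
A product `∏_j θ(z - b_j)` with `∑ b_j = 0` has the quasi-periodicity of `θ_1, …, θ_n`, hence is a
combination of them. Suitable products of this kind diagonalise the matrix of values
`θ_j(u/n - ⟨λ, ε̄_k⟩)`, so the intertwining vectors form an invertible matrix.

Composing first order operators along a path `k_1, …, k_d` of shifts evaluates the `a`-th factor at
`λ` displaced by the earlier shifts and at the spectral parameter `u - (a-1)ħ`. The two changes
cancel in every column of `φ` other than `k_1, …, k_{a-1}`, so row `k_a` of the inverse matrix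
changes only by a combination of the rows `k_1, …, k_{a-1}` of the unshifted inverse.
Antisymmetrisation turns these rows into a determinant, which is therefore the unshifted one and
vanishes when an index is repeated. Thus `M_d` is the sum of the normally ordered principal minors
of `L(c|u)`, which are the coefficients of its normally ordered characteristic polynomial. Finally
`L̃` is conjugate to `L` as a matrix of normally ordered expressions, pointwise in `λ`.
-/

namespace EllipticRuijsenaars

/-! ### Theta series -/

/-- `F` is an everywhere absolutely convergent series `∑ a_k exp (2πi k x)` whose coefficients
satisfy `a_{k+m} = α q^k a_k`, where `q = exp (2πi τ)`. These are the holomorphic functions of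
period `1` that are multiplied by a multiple of `exp (-2πi m x)` under `x ↦ x + τ`, encoded by
their Fourier coefficients. -/
def IsThetaSeries (τ : ℂ) (m : ℤ) (α : ℂ) (F : ℂ → ℂ) : Prop :=
  ∃ a : ℤ → ℂ, (∀ x, HasSum (fun k : ℤ => a k * cexp (2 * Real.pi * I * (k * x))) (F x)) ∧
    ∀ k, a (k + m) = α * cexp (2 * Real.pi * I * (k * τ)) * a k

theorem IsThetaSeries.one (τ : ℂ) : IsThetaSeries τ 0 1 1 := by
  refine ⟨Pi.single 0 1, fun x => ?_, fun k => ?_⟩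
  · convert hasSum_single (0 : ℤ) fun k hk => ?_ using 1 <;> simp_all
  · by_cases hk : k = 0 <;> simp [hk]

theorem hasSum_tsum_sub_mul {G R : Type*} [AddGroup G] [NormedRing R] [CompleteSpace R]
    {f g : G → R} (hf : Summable fun k => ‖f k‖) (hg : Summable fun k => ‖g k‖) :
    HasSum (fun N => ∑' l, f (N - l) * g l) ((∑' k, f k) * ∑' l, g l) := by
  let e : G × G ≃ G × G :=
    ⟨fun p => (p.1 - p.2, p.2), fun p => (p.1 + p.2, p.2), fun p => by simp, fun p => by simp⟩
  have hsummable := summable_mul_of_summable_norm hf hg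
  have h := e.hasSum_iff.mpr (hf.of_norm.hasSum.mul hg.of_norm.hasSum hsummable)
  exact h.prod_fiberwise fun N => (h.summable.prod_factor N).hasSum

theorem IsThetaSeries.mul {τ : ℂ} {m m' : ℤ} {α α' : ℂ} {F G : ℂ → ℂ}
    (hF : IsThetaSeries τ m α F) (hG : IsThetaSeries τ m' α' G) :
    IsThetaSeries τ (m + m') (α * α') (F * G) := by
  obtain ⟨a, ha, ha_add⟩ := hF
  obtain ⟨b, hb, hb_add⟩ := hG
  have hexp : ∀ (x : ℂ) (N l : ℤ), cexp (2 * Real.pi * I * (N * x)) =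
      cexp (2 * Real.pi * I * ((N - l : ℤ) * x)) * cexp (2 * Real.pi * I * (l * x)) := by
    intro x N l
    rw [← Complex.exp_add]
    congr 1
    push_cast
    ring
  refine ⟨fun N => ∑' l, a (N - l) * b l, fun x => ?_, fun N => ?_⟩
  · have h := hasSum_tsum_sub_mul (ha x).summable.norm (hb x).summable.norm
    rw [(ha x).tsum_eq, (hb x).tsum_eq] at h
    refine h.congr_fun fun N => ?_
    rw [← tsum_mul_right]
    exact tsum_congr fun l => by rw [hexp x N l]; ring
  · change ∑' l, a (N + (m + m') - l) * b l = _ * ∑' l, a (N - l) * b l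
    rw [← (Equiv.addRight m').tsum_eq, ← tsum_mul_left]
    refine tsum_congr fun l => ?_
    rw [Equiv.coe_addRight, hb_add, show N + (m + m') - (l + m') = N - l + m by ring, ha_add,
      hexp τ N l]
    ring

theorem IsThetaSeries.prod {ι : Type*} (s : Finset ι) {τ : ℂ} {m : ι → ℤ} {α : ι → ℂ}
    {F : ι → ℂ → ℂ} (h : ∀ i ∈ s, IsThetaSeries τ (m i) (α i) (F i)) :
    IsThetaSeries τ (∑ i ∈ s, m i) (∏ i ∈ s, α i) (∏ i ∈ s, F i) := by
  classical
  induction s using Finset.induction_on with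
  | empty => simpa using IsThetaSeries.one τ
  | insert i s hi ih =>
    rw [Finset.sum_insert hi, Finset.prod_insert hi, Finset.prod_insert hi]
    exact (h i (Finset.mem_insert_self i s)).mul
      (ih fun j hj => h j (Finset.mem_insert_of_mem hj))

theorem theta_zero (τ : ℂ) : theta τ 0 = 0 := by
  have hodd : theta τ 0 = -theta τ 0 := by
    conv_lhs => rw [theta, thetaChar, ← (Equiv.subLeft (-1 : ℤ)).tsum_eq]
    rw [theta, thetaChar, ← tsum_neg]
    refine tsum_congr fun k => ?_
    rw [← Complex.exp_add_pi_mul_I, ← Complex.exp_periodic.int_mul (-k - 1) (_ + Real.pi * I)]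
    congr 1
    rw [Equiv.subLeft_apply]
    push_cast
    ring
  exact self_eq_neg.mp hodd

theorem hasSum_theta {τ : ℂ} (hτ : 0 < τ.im) (x : ℂ) :
    HasSum (fun k : ℤ => cexp (2 * Real.pi * I *
      ((k + 1 / 2) * (x + 1 / 2) + (k + 1 / 2) ^ 2 / 2 * τ))) (theta τ x) := by
  have hsummable := ((summable_jacobiTheta₂_term_iff (x + 1 / 2 + τ / 2) τ).mpr hτ).mul_left
    (cexp (Real.pi * I * (x + 1 / 2 + τ / 4)))
  have htheta : theta τ x = ∑' k : ℤ, cexp (2 * Real.pi * I *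
      ((k + 1 / 2) * (x + 1 / 2) + (k + 1 / 2) ^ 2 / 2 * τ)) := by
    refine tsum_congr fun k => ?_
    push_cast
    ring_nf
  rw [htheta]
  refine (hsummable.congr fun k => ?_).hasSum
  rw [jacobiTheta₂_term, ← Complex.exp_add]
  ring_nf

theorem isThetaSeries_theta {τ : ℂ} (hτ : 0 < τ.im) (b : ℂ) :
    IsThetaSeries τ 1 (cexp (2 * Real.pi * I * (1 / 2 + τ - b)))
      (fun x => cexp (-(Real.pi * I * x)) * theta τ (x - b)) := by
  refine ⟨fun k => cexp (2 * Real.pi * I *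
    ((k + 1 / 2) * (1 / 2 - b) + (k + 1 / 2) ^ 2 / 2 * τ)), fun x => ?_, fun k => ?_⟩
  · refine ((hasSum_theta hτ (x - b)).mul_left (cexp (-(Real.pi * I * x)))).congr_fun fun k => ?_
    rw [← Complex.exp_add, ← Complex.exp_add]
    ring_nf
  · simp only [← Complex.exp_add]
    congr 1
    push_cast
    ring

/-- The coefficient of `exp (2πi (N + n/2) x)` in the Fourier expansions of the functions
`θ_1, …, θ_n`; the exponents of `θ_j` are those with `N ≡ -j` modulo `n`. -/
noncomputable def thetaIdxCoeff (n : ℕ) (τ : ℂ) (N : ℤ) : ℂ :=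
  cexp (2 * Real.pi * I * ((N + n / 2) / 2 + (N + n / 2) ^ 2 / (2 * n) * τ))

theorem thetaIdxCoeff_add {n : ℕ} (hn : n ≠ 0) (τ : ℂ) (N : ℤ) :
    thetaIdxCoeff n τ (N + n) = cexp (2 * Real.pi * I * (n / 2 + n * τ)) *
      cexp (2 * Real.pi * I * (N * τ)) * thetaIdxCoeff n τ N := by
  have hn' : (n : ℂ) ≠ 0 := Nat.cast_ne_zero.mpr hn
  simp only [thetaIdxCoeff, ← Complex.exp_add]
  congr 1
  push_cast
  field_simp
  ring

theorem thetaIdx_eq_tsum {n : ℕ} (τ : ℂ) (j : ℕ) (x : ℂ) :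
    thetaIdx n τ j x = cexp (Real.pi * I * (n * x)) * ∑' k : ℤ,
      thetaIdxCoeff n τ (-j + k * n) * cexp (2 * Real.pi * I * ((-j + k * n : ℤ) * x)) := by
  rw [thetaIdx, thetaChar, ← tsum_mul_left]
  refine tsum_congr fun k => ?_
  rw [thetaIdxCoeff, ← Complex.exp_add, ← Complex.exp_add]
  congr 1
  push_cast
  ring

/-- The equivalence `(j, k) ↦ -(j + 1) + k n`, splitting the integers into the residue classes
that index the Fourier series of `θ_1, …, θ_n`. -/
def residueEquiv (n : ℕ) [NeZero n] : Fin n × ℤ ≃ ℤ :=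
  (Equiv.prodComm _ _).trans <| ((Equiv.neg ℤ).prodCongr (Equiv.refl _)).trans <|
    (Int.divModEquiv n).symm.trans <| (Equiv.neg ℤ).trans (Equiv.subRight 1)

theorem residueEquiv_apply (n : ℕ) [NeZero n] (p : Fin n × ℤ) :
    residueEquiv n p = -((p.1 : ℕ) + 1 : ℕ) + p.2 * n := by
  change -(-p.2 * n + (p.1 : ℕ)) - 1 = (_ : ℤ)
  push_cast
  ring

theorem IsThetaSeries.exists_eq_sum_thetaIdx {n : ℕ} (hn : n ≠ 0) {τ : ℂ} {F : ℂ → ℂ}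
    (hF : IsThetaSeries τ n (cexp (2 * Real.pi * I * (n / 2 + n * τ))) F) :
    ∃ c : Fin n → ℂ, ∀ x,
      cexp (Real.pi * I * (n * x)) * F x = ∑ j : Fin n, c j * thetaIdx n τ (j + 1) x := by
  have : NeZero n := ⟨hn⟩
  obtain ⟨a, ha, ha_add⟩ := hF
  set ratio : ℤ → ℂ := fun N => a N / thetaIdxCoeff n τ N with hratio
  have hratio_mul : ∀ N, ratio N * thetaIdxCoeff n τ N = a N := fun N =>
    div_mul_cancel₀ _ (Complex.exp_ne_zero _)
  have hperiodic : Function.Periodic ratio n := fun N => by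
    simp only [hratio, ha_add, thetaIdxCoeff_add hn]
    exact mul_div_mul_left _ _ (mul_ne_zero (Complex.exp_ne_zero _) (Complex.exp_ne_zero _))
  refine ⟨fun j => ratio (-(j + 1 : ℕ)), fun x => ?_⟩
  have h := (residueEquiv n).hasSum_iff.mpr (ha x)
  have hfiber := (h.prod_fiberwise fun j => (h.summable.prod_factor j).hasSum).unique
    (hasSum_fintype _)
  rw [hfiber, Finset.mul_sum]
  refine Finset.sum_congr rfl fun j _ => ?_
  rw [thetaIdx_eq_tsum]
  refine (congrArg _ ?_).trans (mul_left_comm _ _ _)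
  rw [← tsum_mul_left]
  refine tsum_congr fun k => ?_
  have hshift : ratio (-(j + 1 : ℕ) + k * n) = ratio (-(j + 1 : ℕ)) :=
    hperiodic.int_mul k _
  rw [Function.comp_apply, residueEquiv_apply, ← hratio_mul, hshift, mul_assoc]

theorem exists_prod_theta_sub_eq_sum_thetaIdx {n : ℕ} (hn : n ≠ 0) {τ : ℂ} (hτ : 0 < τ.im)
    {b : Fin n → ℂ} (hb : ∑ j, b j = 0) :
    ∃ c : Fin n → ℂ, ∀ z, ∏ j, theta τ (z - b j) = ∑ j : Fin n, c j * thetaIdx n τ (j + 1) z := by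
  have hprod := IsThetaSeries.prod Finset.univ fun j _ => isThetaSeries_theta hτ (b j)
  have hmult : ∏ j, cexp (2 * Real.pi * I * (1 / 2 + τ - b j)) =
      cexp (2 * Real.pi * I * (n / 2 + n * τ)) := by
    rw [← Complex.exp_sum, ← Finset.mul_sum, Finset.sum_sub_distrib, hb, Finset.sum_const,
      Finset.card_fin, nsmul_eq_mul]
    ring_nf
  rw [hmult, Finset.sum_const, Finset.card_fin, nsmul_eq_mul, mul_one] at hprod
  obtain ⟨c, hc⟩ := hprod.exists_eq_sum_thetaIdx hn
  refine ⟨c, fun z => ?_⟩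
  rw [← hc z, Finset.prod_apply, Finset.prod_mul_distrib, ← Complex.exp_sum, ← mul_assoc,
    ← Complex.exp_add]
  simp [mul_left_comm]

/-- For each `k`, the product of the `θ(z - x_j)` with `j ≠ k` and of one more factor, whose zero
`x_k - ∑ x` makes the zeros sum up to `0`, is a combination of the `θ_j` that vanishes at `x_m`
for all `m ≠ k`. -/
theorem isUnit_det_thetaIdx {n : ℕ} {τ : ℂ} (hτ : 0 < τ.im) (x : Fin n → ℂ)
    (hsum : theta τ (∑ k, x k) ≠ 0) (hne : ∀ i j, i ≠ j → theta τ (x i - x j) ≠ 0) :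
    IsUnit (Matrix.of fun j k : Fin n => thetaIdx n τ (j + 1) (x k)).det := by
  set zeros : Fin n → Fin n → ℂ := fun k => Function.update x k (x k - ∑ l, x l) with hzeros
  have hzeros_sum : ∀ k, ∑ j, zeros k j = 0 := fun k => by
    rw [hzeros, Finset.sum_update_of_mem (Finset.mem_univ k), sub_add_eq_add_sub,
      ← Finset.sum_eq_add_sum_sdiff_singleton_of_mem (Finset.mem_univ k), sub_self]
  choose C hC using fun k =>
    exists_prod_theta_sub_eq_sum_thetaIdx (Fin.pos k).ne' hτ (hzeros_sum k)
  have hdiag : Matrix.of C * Matrix.of (fun j k : Fin n => thetaIdx n τ (j + 1) (x k)) =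
      Matrix.diagonal fun k => ∏ j, theta τ (x k - zeros k j) := by
    ext k m
    simp only [Matrix.mul_apply, Matrix.of_apply, ← hC k (x m)]
    rcases eq_or_ne k m with rfl | hkm
    · rw [Matrix.diagonal_apply_eq]
    · rw [Matrix.diagonal_apply_ne _ hkm]
      refine Finset.prod_eq_zero (Finset.mem_univ m) ?_
      simp only [hzeros, Function.update_of_ne hkm.symm, sub_self, theta_zero]
  refine isUnit_of_mul_isUnit_right (x := (Matrix.of C).det) ?_
  rw [← Matrix.det_mul, hdiag, Matrix.det_diagonal, isUnit_iff_ne_zero]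
  refine Finset.prod_ne_zero_iff.mpr fun k _ => Finset.prod_ne_zero_iff.mpr fun j _ => ?_
  rcases eq_or_ne j k with rfl | hjk
  · simpa [hzeros] using hsum
  · simpa [hzeros, hjk] using hne k j hjk.symm

/-! ### Determinants -/

theorem sum_det_submatrix_orderEmbedding {ι R : Type*} [Fintype ι] [LinearOrder ι] [CommRing R]
    (A : Matrix ι ι R) (d : ℕ) :
    ∑ i : Fin d ↪o ι, (A.submatrix i i).det =
      ∑ s ∈ (Finset.univ : Finset ι).powersetCard d,
        (A.submatrix (Subtype.val : s → ι) Subtype.val).det := by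
  rw [← Set.powersetCard.ofFinEmbEquiv.symm.sum_comp,
    Finset.sum_subtype (p := (· ∈ Set.powersetCard ι d)) _ fun s => by
      simp [Finset.mem_powersetCard, Set.powersetCard.mem_iff]]
  refine Finset.sum_congr rfl fun s _ => ?_
  rw [← Matrix.det_submatrix_equiv_self (s.1.orderIsoOfFin s.2).toEquiv]
  rfl

theorem det_sub_smul_one {ι R K : Type*} [Fintype ι] [LinearOrder ι] [CommRing R] [CommRing K]
    [Algebra K R] (A : Matrix ι ι R) (t : K) :
    (A - t • 1).det = ∑ d ∈ Finset.range (Fintype.card ι + 1),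
      (-t) ^ (Fintype.card ι - d) • ∑ i : Fin d ↪o ι, (A.submatrix i i).det := by
  nontriviality R
  set N := Fintype.card ι
  set r := algebraMap K R t
  have hcharpoly : (A - t • 1).det = (-1) ^ N * A.charpoly.eval r := by
    rw [Matrix.eval_charpoly, ← Matrix.det_neg, neg_sub, ← algebraMap_smul R t,
      Matrix.smul_one_eq_diagonal]
    rfl
  rw [hcharpoly, Polynomial.eval_eq_sum_range, A.charpoly_natDegree_eq_dim,
    ← Finset.sum_range_reflect, Finset.mul_sum]
  refine Finset.sum_congr rfl fun d hd => ?_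
  have hdN : d ≤ N := Nat.lt_succ_iff.mp (Finset.mem_range.mp hd)
  have hsign : (-1 : R) ^ N * (-1) ^ d = (-1) ^ (N - d) := by
    rw [← pow_add, ← Nat.sub_add_cancel hdN, add_assoc, ← two_mul, pow_add, pow_mul]
    simp
  rw [Nat.add_sub_cancel, A.charpoly_coeff_eq_sum_minors d hdN, sum_det_submatrix_orderEmbedding,
    Algebra.smul_def, map_pow, map_neg, neg_pow (algebraMap K R t), ← hsign]
  ring

theorem sum_sign_smul_prod_mul {ι R : Type*} [Fintype ι] [DecidableEq ι] [CommRing R]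
    (p : ι → R) (Q : Matrix ι ι R) :
    ∑ σ : Equiv.Perm ι, (Equiv.Perm.sign σ : ℤ) • ∏ a, (p a * Q a (σ a)) =
      (∏ a, p a) * Q.det := by
  rw [← Q.det_transpose, Matrix.det_apply, Finset.mul_sum]
  refine Finset.sum_congr rfl fun σ _ => ?_
  rw [Finset.prod_mul_distrib, Units.smul_def, mul_smul_comm]
  rfl

theorem det_eq_of_sub_mem_span_rows_lt {ι R : Type*} [Fintype ι] [LinearOrder ι]
    [LocallyFiniteOrderBot ι] [CommRing R] {M N : Matrix ι ι R}
    (h : ∀ a, M a - N a ∈ Submodule.span R (N '' Set.Iio a)) : M.det = N.det := by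
  have hcoeff : ∀ a, ∃ c : ι → R, ∑ b ∈ Finset.Iio a, c b • N b = M a - N a := fun a => by
    refine (Submodule.mem_span_image_finset_iff_exists_fun' (v := fun b => N b) (R := R)).mp ?_
    rw [Finset.coe_Iio]
    exact h a
  choose c hc using hcoeff
  set U : Matrix ι ι R := Matrix.of fun a b => if b < a then c a b else (1 : Matrix ι ι R) a b
    with hU
  have hUN : M = U * N := by
    ext a j
    have hterm : ∀ b, U a b * N b j =
        (if b ∈ Finset.Iio a then c a b * N b j else 0) + (1 : Matrix ι ι R) a b * N b j := by
      intro b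
      by_cases hb : b < a
      · simp [hU, hb, hb.ne']
      · simp [hU, hb]
    have hrow := congrFun (hc a) j
    simp only [Finset.sum_apply, Pi.smul_apply, smul_eq_mul, Pi.sub_apply] at hrow
    rw [Matrix.mul_apply, Finset.sum_congr rfl fun b _ => hterm b, Finset.sum_add_distrib,
      Finset.sum_ite_mem, Finset.univ_inter, hrow, ← Matrix.mul_apply, Matrix.one_mul,
      sub_add_cancel]
  have hlower : U.IsLowerTriangular := fun a b (hab : a < b) => by
    simp [hU, hab.not_gt, hab.ne]
  rw [hUN, Matrix.det_mul, Matrix.det_of_isLowerTriangular U hlower]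
  simp [hU]

/-- Pairing the row `k_a` of `(Ψ a)⁻¹` with the columns of `Φ` shows that it differs from the row
`k_a` of `Φ⁻¹` by a combination of rows `k_b` of `Φ⁻¹` with `b < a`. -/
theorem det_inv_rows_eq_of_cols_eq {ι κ R : Type*} [Fintype ι] [DecidableEq ι] [Fintype κ]
    [LinearOrder κ] [LocallyFiniteOrderBot κ] [CommRing R] {Φ : Matrix ι ι R}
    (hΦ : IsUnit Φ.det) {Ψ : κ → Matrix ι ι R} (hΨ : ∀ a, IsUnit (Ψ a).det) {k : κ → ι}
    (hcol : ∀ a i j, (∀ b < a, k b ≠ j) → Ψ a i j = Φ i j) (i : κ → ι) :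
    (Matrix.of fun a b => (Ψ a)⁻¹ (k a) (i b)).det =
      (Matrix.of fun a b => Φ⁻¹ (k a) (i b)).det := by
  refine det_eq_of_sub_mem_span_rows_lt fun a => ?_
  set C : Matrix ι ι R := (Ψ a)⁻¹ * Φ - 1 with hC
  have hC_zero : ∀ j, (∀ b < a, k b ≠ j) → C (k a) j = 0 := by
    intro j hj
    have hΦΨ : ((Ψ a)⁻¹ * Φ) (k a) j = ((Ψ a)⁻¹ * Ψ a) (k a) j := by
      simp only [Matrix.mul_apply, hcol a _ j hj]
    rw [hC, Matrix.sub_apply, hΦΨ, Matrix.nonsing_inv_mul _ (hΨ a), sub_self]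
  have hdiff : (Ψ a)⁻¹ - Φ⁻¹ = C * Φ⁻¹ := by
    rw [hC, Matrix.sub_mul, Matrix.mul_assoc, Matrix.mul_nonsing_inv _ hΦ, Matrix.mul_one,
      Matrix.one_mul]
  have hrow : (fun b => (Ψ a)⁻¹ (k a) (i b)) - (fun b => Φ⁻¹ (k a) (i b)) =
      ∑ j, C (k a) j • fun b => Φ⁻¹ j (i b) := by
    ext b
    rw [Finset.sum_apply]
    exact (congrFun (congrFun hdiff (k a)) (i b)).trans (Matrix.mul_apply ..)
  refine hrow ▸ Submodule.sum_mem _ fun j _ => ?_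
  by_cases hj : ∀ b < a, k b ≠ j
  · simp [hC_zero j hj]
  · obtain ⟨b, hba, rfl⟩ : ∃ b < a, k b = j := by simpa using hj
    exact Submodule.smul_mem _ _ (Submodule.subset_span ⟨b, hba, rfl⟩)

/-! ### Products of first order difference operators -/

theorem quantize_smul {n : ℕ} (g : Fn n) (s : DiffSymbol n) :
    quantize (g • s) = mulOp g * quantize s := by
  ext f v
  rw [Module.End.mul_apply, quantize_apply, AddMonoidAlgebra.coeff_smul,
    Finsupp.sum_smul_index' fun w => by simp]
  change _ = g v * quantize s f v
  rw [quantize_apply, Finsupp.mul_sum]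
  exact Finsupp.sum_congr fun w _ => by simp [mul_assoc]

/-- The linear map sending a normally ordered expression to its difference operator. -/
noncomputable def quantizeLinearMap (n : ℕ) : DiffSymbol n →ₗ[ℂ] Op n where
  toFun := quantize
  map_add' := quantize_add
  map_smul' r s := by
    rw [← algebraMap_smul (Fn n) r s, quantize_smul]
    rfl

theorem quantizeLinearMap_apply {n : ℕ} (s : DiffSymbol n) : quantizeLinearMap n s = quantize s :=
  rfl

theorem quantize_one {n : ℕ} : quantize (1 : DiffSymbol n) = 1 := by
  rw [AddMonoidAlgebra.one_def, quantize_single]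
  ext f v
  simp [mulOp, shiftOp]

/-- Evaluation at `v` of the coefficients of a normally ordered expression. -/
noncomputable def coeffEval {n : ℕ} (v : weightSpace n) :
    DiffSymbol n →ₐ[ℂ] AddMonoidAlgebra ℂ (weightSpace n) :=
  AddMonoidAlgebra.mapAlgHom _ (Pi.evalAlgHom ℂ (fun _ => ℂ) v)

theorem coeffEval_smul {n : ℕ} (v : weightSpace n) (g : Fn n) (s : DiffSymbol n) :
    coeffEval v (g • s) = g v • coeffEval v s := by
  ext w
  simp [coeffEval]

theorem quantize_apply_congr {n : ℕ} {s s' : DiffSymbol n} {v : weightSpace n}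
    (h : coeffEval v s = coeffEval v s') (f : Fn n) : quantize s f v = quantize s' f v := by
  have hquantize : ∀ r : DiffSymbol n,
      quantize r f v = (coeffEval v r).coeff.sum fun w a => a * f (v + w) := by
    intro r
    rw [quantize_apply]
    exact (Finsupp.sum_mapRange_index (f := fun a : Fn n => a v) (hf := rfl)
      (h := fun w a => a * f (v + w)) fun w => zero_mul _).symm
  rw [hquantize, hquantize, h]

theorem normalDet_map_quantize_sub_smul_one {n : ℕ} (S : Matrix (Fin n) (Fin n) (DiffSymbol n))
    (t : ℂ) : normalDet (S.map quantize - t • 1) = quantize (S - t • 1).det := by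
  have hsymbol : (S - t • 1 : Matrix (Fin n) (Fin n) (DiffSymbol n)).map quantize =
      S.map quantize - t • 1 := by
    change (S - t • 1 : Matrix (Fin n) (Fin n) (DiffSymbol n)).map (quantizeLinearMap n) = _
    rw [Matrix.map_sub _ (map_sub _), Matrix.map_smul _ _ (map_smul _ t),
      Matrix.map_one _ (map_zero _) quantize_one]
    rfl
  rw [normalDet, ← hsymbol, Matrix.map_map]
  congr 2
  ext1 i j
  exact symbol_quantize _

/-- The normally ordered expression `∑_k C_k(λ) T^{s_k}`. -/
noncomputable def firstOrderSymbol {n : ℕ} {ι : Type*} [Fintype ι] (s : ι → weightSpace n)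
    (C : ι → Fn n) : DiffSymbol n :=
  ∑ k, AddMonoidAlgebra.single (s k) (C k)

theorem quantize_firstOrderSymbol {n : ℕ} {ι : Type*} [Fintype ι] (s : ι → weightSpace n)
    (C : ι → Fn n) : quantize (firstOrderSymbol s C) = ∑ k, mulOp (C k) * shiftOp (s k) := by
  simp only [firstOrderSymbol, ← quantizeLinearMap_apply, map_sum]
  simp only [quantizeLinearMap_apply, quantize_single]

/-- The displacement `∑_{b < a} s_{k_b}` accumulated before the `a`-th step of the path `k`. -/
def partialShift {V ι : Type*} [AddCommMonoid V] {d : ℕ} (s : ι → V) (k : Fin d → ι)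
    (a : Fin d) : V :=
  ∑ b ∈ Finset.Iio a, s (k b)

theorem partialShift_cons_zero {V ι : Type*} [AddCommMonoid V] {d : ℕ} (s : ι → V) (k₀ : ι)
    (k : Fin d → ι) : partialShift s (Fin.cons k₀ k : Fin (d + 1) → ι) 0 = 0 :=
  Finset.sum_eq_zero fun b hb => absurd (Finset.mem_Iio.mp hb) (Fin.not_lt_zero b)

theorem partialShift_cons_succ {V ι : Type*} [AddCommMonoid V] {d : ℕ} (s : ι → V) (k₀ : ι)
    (k : Fin d → ι) (a : Fin d) :
    partialShift s (Fin.cons k₀ k : Fin (d + 1) → ι) a.succ = s k₀ + partialShift s k a := by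
  have hIio : ∀ {m : ℕ} (c : Fin m), Finset.Iio c = Finset.univ.filter (· < c) :=
    fun c => by ext; simp
  simp only [partialShift, hIio, Finset.sum_filter, Fin.sum_univ_succ, Fin.cons_zero,
    Fin.cons_succ, Fin.succ_lt_succ_iff, Fin.succ_pos, if_true]

theorem prod_ofFn_quantize_firstOrderSymbol_apply {n d : ℕ} {ι : Type*} [Fintype ι]
    (s : ι → weightSpace n) (C : Fin d → ι → Fn n) (f : Fn n) (v : weightSpace n) :
    (List.ofFn fun a => quantize (firstOrderSymbol s (C a))).prod f v =
      ∑ k : Fin d → ι, (∏ a, C a (k a) (v + partialShift s k a)) * f (v + ∑ a, s (k a)) := by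
  induction d generalizing v with
  | zero => simp
  | succ d ih =>
    rw [List.ofFn_succ, List.prod_cons, Module.End.mul_apply, quantize_firstOrderSymbol,
      LinearMap.sum_apply, Finset.sum_apply, ← (Fin.consEquiv fun _ => ι).sum_comp,
      Fintype.sum_prod_type]
    refine Finset.sum_congr rfl fun k₀ _ => ?_
    change C 0 k₀ v * (List.ofFn fun a : Fin d =>
      quantize (firstOrderSymbol s (C a.succ))).prod f (v + s k₀) = _
    rw [ih (fun a => C a.succ), Finset.mul_sum]
    refine Finset.sum_congr rfl fun k _ => ?_
    have hcons : (Fin.consEquiv fun _ => ι) (k₀, k) = Fin.cons k₀ k := rfl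
    simp only [hcons, Fin.prod_univ_succ, Fin.sum_univ_succ, partialShift_cons_zero,
      partialShift_cons_succ, Fin.cons_zero, Fin.cons_succ, add_zero, add_assoc, mul_assoc]

theorem quantize_prod_firstOrderSymbol_apply {n d : ℕ} {ι : Type*} [Fintype ι]
    (s : ι → weightSpace n) (C : Fin d → ι → Fn n) (f : Fn n) (v : weightSpace n) :
    quantize (∏ a, firstOrderSymbol s (C a)) f v =
      ∑ k : Fin d → ι, (∏ a, C a (k a) v) * f (v + ∑ a, s (k a)) := by
  classical
  simp only [firstOrderSymbol, Fintype.prod_sum, AddMonoidAlgebra.prod_single]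
  change quantize (firstOrderSymbol (fun k : Fin d → ι => ∑ a, s (k a))
    fun k => ∏ a, C a (k a)) f v = _
  simp [quantize_firstOrderSymbol, LinearMap.sum_apply, Finset.sum_apply, mulOp, shiftOp]

theorem sum_sign_smul_prod_ofFn_quantize_apply {n d : ℕ} {ι : Type*} [Fintype ι]
    (s : ι → weightSpace n) (p : Fin d → ι → Fn n) (q : Fin d → ι → Fin d → Fn n) (f : Fn n)
    (v : weightSpace n) :
    (∑ σ : Equiv.Perm (Fin d), (Equiv.Perm.sign σ : ℤ) • (List.ofFn fun a =>
        quantize (firstOrderSymbol s fun k => p a k * q a k (σ a))).prod) f v =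
      ∑ k : Fin d → ι, (∏ a, p a (k a) (v + partialShift s k a)) *
        (Matrix.of fun a b => q a (k a) b (v + partialShift s k a)).det *
          f (v + ∑ a, s (k a)) := by
  simp only [LinearMap.sum_apply, Finset.sum_apply, LinearMap.smul_apply, Pi.smul_apply,
    prod_ofFn_quantize_firstOrderSymbol_apply, Finset.smul_sum]
  rw [Finset.sum_comm]
  refine Finset.sum_congr rfl fun k _ => ?_
  rw [← sum_sign_smul_prod_mul, Finset.sum_mul]
  exact Finset.sum_congr rfl fun σ _ => (smul_mul_assoc _ _ _).symm

theorem quantize_det_firstOrderSymbol_apply {n d : ℕ} {ι : Type*} [Fintype ι]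
    (s : ι → weightSpace n) (p : Fin d → ι → Fn n) (q : ι → Fin d → Fn n) (f : Fn n)
    (v : weightSpace n) :
    quantize (Matrix.of fun b a => firstOrderSymbol s fun k => p a k * q k b).det f v =
      ∑ k : Fin d → ι, (∏ a, p a (k a) v) * (Matrix.of fun a b => q (k a) b v).det *
        f (v + ∑ a, s (k a)) := by
  rw [Matrix.det_apply]
  simp only [Units.smul_def, ← quantizeLinearMap_apply, map_sum, map_zsmul]
  simp only [quantizeLinearMap_apply, Matrix.of_apply, LinearMap.sum_apply, Finset.sum_apply,
    LinearMap.smul_apply, Pi.smul_apply, quantize_prod_firstOrderSymbol_apply, Finset.smul_sum]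
  rw [Finset.sum_comm]
  refine Finset.sum_congr rfl fun k _ => ?_
  rw [← sum_sign_smul_prod_mul, Finset.sum_mul]
  exact Finset.sum_congr rfl fun σ _ => (smul_mul_assoc _ _ _).symm

/-! ### Intertwining vectors -/

theorem pairing_epsBar {n : ℕ} (v : weightSpace n) (k : Fin n) :
    pairing v (epsBar n k) = v.1 k := by
  have hv : ∑ i, v.1 i = 0 := v.2
  simp [pairing, epsBar, mul_sub, Finset.sum_sub_distrib, ← Finset.sum_mul, hv]

theorem pairing_epsBar_sub {n : ℕ} (v : weightSpace n) (i j : Fin n) :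
    pairing v (epsBar n i - epsBar n j) = v.1 i - v.1 j := by
  rw [← pairing_epsBar, ← pairing_epsBar]
  simp [pairing, mul_sub, Finset.sum_sub_distrib]

theorem partialShift_smul_epsBar_apply {n d : ℕ} (ℏ : ℂ) (k : Fin d → Fin n) (a : Fin d)
    (j : Fin n) :
    (partialShift (ℏ • epsBar n) k a).1 j = ℏ * {b ∈ Finset.Iio a | k b = j}.card - a * ℏ / n := by
  have hstep : ∀ b, ((ℏ • epsBar n) (k b)).1 j = ℏ * (if k b = j then 1 else 0) - ℏ / n := by
    intro b
    simp only [Pi.smul_apply, epsBar, Submodule.coe_smul, smul_eq_mul, eq_comm (a := j)]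
    ring
  rw [partialShift, Submodule.coe_sum, Finset.sum_apply, Finset.sum_congr rfl fun b _ => hstep b,
    Finset.sum_sub_distrib, ← Finset.mul_sum, Finset.sum_boole, Finset.sum_const, Fin.card_Iio,
    nsmul_eq_mul, mul_div_assoc]

theorem isUnit_det_outVec {n : ℕ} (hn : n ≠ 0) {τ : ℂ} (hτ : 0 < τ.im) {w : ℂ}
    (hw : theta τ w ≠ 0) {v : weightSpace n}
    (hv : ∀ i j, i ≠ j → theta τ (v.1 i - v.1 j) ≠ 0) : IsUnit (outVec n τ w v).det := by
  have hη : (I * ModularForm.eta τ)⁻¹ ≠ 0 :=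
    inv_ne_zero (mul_ne_zero I_ne_zero (ModularForm.eta_ne_zero hτ))
  have houtVec : outVec n τ w v = (I * ModularForm.eta τ)⁻¹ •
      Matrix.of fun j k : Fin n => thetaIdx n τ (j + 1) (w / n - v.1 k) := by
    ext j k
    rw [outVec, Matrix.of_apply, pairing_epsBar, div_eq_inv_mul]
    rfl
  have hsum : ∑ k, (w / n - v.1 k) = w := by
    have hv_sum : ∑ k, v.1 k = 0 := v.2
    rw [Finset.sum_sub_distrib, hv_sum, Finset.sum_const, Finset.card_fin, nsmul_eq_mul, sub_zero,
      mul_div_cancel₀ _ (Nat.cast_ne_zero.mpr hn)]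
  rw [houtVec, Matrix.det_smul]
  refine (hη.isUnit.pow _).mul (isUnit_det_thetaIdx hτ _ (hsum.symm ▸ hw) fun i j hij => ?_)
  rw [sub_sub_sub_cancel_left]
  exact hv j i hij.symm

theorem isUnit_det_outVec_of_mem_regularSet {n : ℕ} {τ ℏ u : ℂ} (hτ : 0 < τ.im)
    (hu : ∀ k : ℕ, k < n → theta τ (u - k * ℏ) ≠ 0) {v : weightSpace n}
    (hv : v ∈ regularSet n τ ℏ) : IsUnit (outVec n τ u v).det := by
  obtain rfl | hn := n.eq_zero_or_pos
  · simp
  refine isUnit_det_outVec hn.ne' hτ (by simpa using hu 0 hn) fun i j hij => ?_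
  simpa [pairing_epsBar_sub] using hv i j hij 0 (by simpa using hn)

theorem isUnit_det_outVec_add_partialShift {n d : ℕ} (hd : d ≤ n) {τ ℏ u : ℂ} (hτ : 0 < τ.im)
    (hu : ∀ k : ℕ, k < n → theta τ (u - k * ℏ) ≠ 0) {v : weightSpace n}
    (hv : v ∈ regularSet n τ ℏ) (k : Fin d → Fin n) (a : Fin d) :
    IsUnit (outVec n τ (u - (a : ℕ) * ℏ) (v + partialShift (ℏ • epsBar n) k a)).det := by
  have han : (a : ℕ) < n := a.2.trans_le hd
  refine isUnit_det_outVec (by omega) hτ (hu a han) fun i j hij => ?_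
  have hvisits : ∀ j, {b ∈ Finset.Iio a | k b = j}.card < n := fun j =>
    ((Finset.card_filter_le _ _).trans_eq (Fin.card_Iio a)).trans_lt han
  have hregular := hv i j hij (({b ∈ Finset.Iio a | k b = i}.card : ℤ) -
    {b ∈ Finset.Iio a | k b = j}.card) (by have := hvisits i; have := hvisits j; rw [abs_lt]; omega)
  rw [pairing_epsBar_sub] at hregular
  simp only [Submodule.coe_add, Pi.add_apply, partialShift_smul_epsBar_apply]
  convert hregular using 2
  push_cast
  ring

/-- Lowering the spectral parameter by `aħ` compensates the displacement `-aħ/n` which `a` shifts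
produce in every direction. -/
theorem outVec_add_partialShift_of_forall_ne {n d : ℕ} (τ ℏ w : ℂ) (v : weightSpace n)
    {k : Fin d → Fin n} {a : Fin d} {j : Fin n} (hj : ∀ b < a, k b ≠ j) (i : Fin n) :
    outVec n τ (w - (a : ℕ) * ℏ) (v + partialShift (ℏ • epsBar n) k a) i j =
      outVec n τ w v i j := by
  have hvisits : {b ∈ Finset.Iio a | k b = j} = (∅ : Finset (Fin d)) :=
    Finset.filter_eq_empty_iff.mpr fun b hb => hj b (Finset.mem_Iio.mp hb)
  simp only [outVec, Matrix.of_apply, pairing_epsBar, Submodule.coe_add, Pi.add_apply,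
    partialShift_smul_epsBar_apply, hvisits, Finset.card_empty, Nat.cast_zero]
  ring_nf

theorem prod_outVec_mul_det_inVec_add_partialShift {n d : ℕ} (hd : d ≤ n) {τ ℏ u : ℂ}
    (hτ : 0 < τ.im) (hu : ∀ k : ℕ, k < n → theta τ (u - k * ℏ) ≠ 0) (w : ℂ) {v : weightSpace n}
    (hv : v ∈ regularSet n τ ℏ) (i k : Fin d → Fin n) :
    (∏ a : Fin d, outVec n τ (w - (a : ℕ) * ℏ) (v + partialShift (ℏ • epsBar n) k a) (i a) (k a)) *
        (Matrix.of fun a b : Fin d => inVec n τ (u - (a : ℕ) * ℏ)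
          (v + partialShift (ℏ • epsBar n) k a) (k a) (i b)).det =
      (∏ a, outVec n τ w v (i a) (k a)) *
        (Matrix.of fun a b => inVec n τ u v (k a) (i b)).det := by
  have hdet := det_inv_rows_eq_of_cols_eq (isUnit_det_outVec_of_mem_regularSet hτ hu hv)
    (isUnit_det_outVec_add_partialShift hd hτ hu hv k)
    (fun _ l _ hj => outVec_add_partialShift_of_forall_ne τ ℏ u v hj l) i
  simp only [inVec]
  rw [hdet]
  by_cases hk : Function.Injective k
  · congr 1
    exact Finset.prod_congr rfl fun a _ =>
      outVec_add_partialShift_of_forall_ne τ ℏ w v (fun b hb h => hb.ne (hk h)) (i a)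
  · obtain ⟨a, b, hab, hne⟩ := Function.not_injective_iff.mp hk
    have hzero : (Matrix.of fun a b => (outVec n τ u v)⁻¹ (k a) (i b)).det = 0 :=
      Matrix.det_zero_of_row_eq hne (by ext c; simp [hab])
    rw [hzero, mul_zero, mul_zero]

/-! ### The L-operator and its transfer matrices -/

/-- The matrix of normally ordered expressions of the entries of `L(c|u)`. -/
noncomputable def lSymbol (n : ℕ) (τ ℏ c u : ℂ) : Matrix (Fin n) (Fin n) (DiffSymbol n) :=
  Matrix.of fun i j => firstOrderSymbol (ℏ • epsBar n) fun k μ =>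
    outVec n τ (u + c * ℏ) μ j k * inVec n τ u μ k i

theorem map_quantize_lSymbol (n : ℕ) (τ ℏ c u : ℂ) :
    (lSymbol n τ ℏ c u).map quantize = lOp n τ ℏ c u := by
  ext1 i j
  rw [Matrix.map_apply, lSymbol, Matrix.of_apply, quantize_firstOrderSymbol]
  rfl

/-- The matrix of normally ordered expressions of the entries of `L̃(c|u)`. -/
noncomputable def lTildeSymbol (n : ℕ) (τ ℏ c u : ℂ) : Matrix (Fin n) (Fin n) (DiffSymbol n) :=
  Matrix.of fun i' j' => ∑ i, ∑ j,
    (fun v => inVec n τ u v j' j * outVec n τ u v i i' : Fn n) • lSymbol n τ ℏ c u i j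

theorem map_quantize_lTildeSymbol (n : ℕ) (τ ℏ c u : ℂ) :
    (lTildeSymbol n τ ℏ c u).map quantize = lTildeOp n τ ℏ c u := by
  ext1 i' j'
  rw [Matrix.map_apply, lTildeSymbol, Matrix.of_apply, ← quantizeLinearMap_apply]
  simp only [map_sum]
  simp only [quantizeLinearMap_apply, quantize_smul, lTildeOp, Matrix.of_apply,
    ← map_quantize_lSymbol, Matrix.map_apply]

theorem transferM_apply_eq_quantize {n d : ℕ} (hd : d ≤ n) {τ ℏ : ℂ} (hτ : 0 < τ.im) (c : ℂ)
    {u : ℂ} (hu : ∀ k : ℕ, k < n → theta τ (u - k * ℏ) ≠ 0) (f : Fn n) {v : weightSpace n}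
    (hv : v ∈ regularSet n τ ℏ) :
    transferM n τ ℏ c u d f v =
      quantize (∑ i : Fin d ↪o Fin n, ((lSymbol n τ ℏ c u).submatrix i i).det) f v := by
  rw [← quantizeLinearMap_apply, map_sum, transferM, Matrix.trace]
  simp only [LinearMap.sum_apply, Finset.sum_apply]
  refine Finset.sum_congr rfl fun i _ => ?_
  have hfused := sum_sign_smul_prod_ofFn_quantize_apply (ℏ • epsBar n)
    (fun a k μ => outVec n τ (u - (a : ℕ) * ℏ + c * ℏ) μ (i a) k)
    (fun a k b μ => inVec n τ (u - (a : ℕ) * ℏ) μ k (i b)) f v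
  have hminor := quantize_det_firstOrderSymbol_apply (ℏ • epsBar n)
    (fun a k μ => outVec n τ (u + c * ℏ) μ (i a) k) (fun k b μ => inVec n τ u μ k (i b)) f v
  refine Eq.trans ?_ ((hfused.trans (Finset.sum_congr rfl fun k _ => ?_)).trans hminor.symm)
  · simp only [Matrix.diag_apply, fusedL, Matrix.of_apply, ← map_quantize_lSymbol]
    rfl
  · congr 1
    simp only [sub_add_eq_add_sub]
    exact prod_outVec_mul_det_inVec_add_partialShift hd hτ hu (u + c * ℏ) hv i k

theorem normalDet_lOp_sub_smul_one (n : ℕ) (τ ℏ c u t : ℂ) :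
    normalDet (lOp n τ ℏ c u - t • 1) = ∑ d ∈ Finset.range (n + 1), (-t) ^ (n - d) •
      quantize (∑ i : Fin d ↪o Fin n, ((lSymbol n τ ℏ c u).submatrix i i).det) := by
  rw [← map_quantize_lSymbol, normalDet_map_quantize_sub_smul_one, det_sub_smul_one,
    ← quantizeLinearMap_apply, map_sum, Fintype.card_fin]
  simp only [map_smul]
  rfl

theorem coeffEval_det_lTildeSymbol_sub_smul_one {n : ℕ} {τ u : ℂ} {v : weightSpace n}
    (hv : IsUnit (outVec n τ u v).det) (ℏ c t : ℂ) :
    coeffEval v (lTildeSymbol n τ ℏ c u - t • 1).det =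
      coeffEval v (lSymbol n τ ℏ c u - t • 1).det := by
  set X := (outVec n τ u v).transpose.map
    (algebraMap ℂ (AddMonoidAlgebra ℂ (weightSpace n))) with hX
  set Y := (inVec n τ u v).transpose.map
    (algebraMap ℂ (AddMonoidAlgebra ℂ (weightSpace n))) with hY
  have hXY : X * Y = 1 := by
    rw [hX, hY, ← Matrix.map_mul, ← Matrix.transpose_mul, inVec, Matrix.nonsing_inv_mul _ hv,
      Matrix.transpose_one, Matrix.map_one _ (map_zero _) (map_one _)]
  have hconj : (coeffEval v).mapMatrix (lTildeSymbol n τ ℏ c u) =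
      X * (coeffEval v).mapMatrix (lSymbol n τ ℏ c u) * Y := by
    ext1 i' j'
    simp only [Matrix.mul_apply, AlgHom.mapMatrix_apply, Matrix.map_apply, lTildeSymbol,
      Matrix.of_apply, map_sum, coeffEval_smul, hX, hY, Matrix.transpose_apply, Finset.sum_mul]
    rw [Finset.sum_comm]
    refine Finset.sum_congr rfl fun j _ => Finset.sum_congr rfl fun i _ => ?_
    rw [Algebra.smul_def, map_mul]
    ring
  have hconj_sub : X * ((coeffEval v).mapMatrix (lSymbol n τ ℏ c u) - t • 1) * Y =
      X * (coeffEval v).mapMatrix (lSymbol n τ ℏ c u) * Y - t • 1 := by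
    rw [Matrix.mul_sub, Matrix.sub_mul, Matrix.mul_smul, Matrix.smul_mul, Matrix.mul_one, hXY]
  rw [AlgHom.map_det, AlgHom.map_det, map_sub, map_sub, map_smul, map_one, hconj, ← hconj_sub,
    Matrix.det_conj_of_mul_eq_one hXY (mul_eq_one_comm.mp hXY)]

theorem normalDet_lTildeOp_sub_smul_one_apply {n : ℕ} {τ u : ℂ} {v : weightSpace n}
    (hv : IsUnit (outVec n τ u v).det) (ℏ c t : ℂ) (f : Fn n) :
    normalDet (lTildeOp n τ ℏ c u - t • 1) f v = normalDet (lOp n τ ℏ c u - t • 1) f v := by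
  rw [← map_quantize_lTildeSymbol, ← map_quantize_lSymbol, normalDet_map_quantize_sub_smul_one,
    normalDet_map_quantize_sub_smul_one]
  exact quantize_apply_congr (coeffEval_det_lTildeSymbol_sub_smul_one hv ℏ c t) f

end EllipticRuijsenaars

open EllipticRuijsenaars in
theorem theorem3 (n : ℕ) (hn : 1 < n) (τ ℏ : ℂ) (hτ : 0 < τ.im)
    (hℏ : ∀ a b : ℤ, ℏ ≠ a + b * τ) (c u : ℂ)
    (hu : ∀ k : ℕ, k < n → theta τ (u - k * ℏ) ≠ 0) (t : ℂ)
    (f : weightSpace n → ℂ) (v : weightSpace n) (hv : v ∈ regularSet n τ ℏ) :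
    (∑ d ∈ Finset.range (n + 1), (-t) ^ (n - d) • transferM n τ ℏ c u d) f v =
      normalDet (lOp n τ ℏ c u - t • 1) f v ∧
    (∑ d ∈ Finset.range (n + 1), (-t) ^ (n - d) • transferM n τ ℏ c u d) f v =
      normalDet (lTildeOp n τ ℏ c u - t • 1) f v := by
  rw [normalDet_lTildeOp_sub_smul_one_apply (isUnit_det_outVec_of_mem_regularSet hτ hu hv),
    and_self, normalDet_lOp_sub_smul_one]
  simp only [LinearMap.sum_apply, Finset.sum_apply, LinearMap.smul_apply, Pi.smul_apply]
  refine Finset.sum_congr rfl fun d hd => ?_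
  rw [transferM_apply_eq_quantize (Finset.mem_range_succ_iff.mp hd) hτ c hu f hv]
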